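/- Let $\Omega$ be the category of finite rooted (symmetric) trees, whose morphisms $S\to T$ are the morphisms of coloured symmetric operads $\Omega(S)\to\Omega(T)$ between the free operads generated by the trees. A dendroidal set is a presheaf of sets on $\Omega$; write $\Omega[T]$ for the presheaf represented by $T$, and $\partial\Omega[T]\subseteq\Omega[T]$ for its boundary, i.e. the union of the images of all proper faces of $T$ (monomorphisms $R\to T$ in $\Omega$ that are not isomorphisms). For $n\ge 0$ let $\Delta[n]=\Omega[[n]]$, where $[n]$ is the linear tree with $n+1$ edges (and $n$ vertices, all unary), with boundary $\partial\Delta[n]$. Let $\otimes$ be the tensor product of dendroidal sets, i.e. the extension by colimits in both variables of $\Omega[S]\otimes\Omega[T]=N(\Omega(S)\otimes_{BV}\Omega(T))$, where $\otimes_{BV}$ is the Boardman–Vogt tensor product of operads and $N$ is the dendroidal nerve, $N(P)_R=\mathrm{Hom}(\Omega(R),P)$. A monomorphism $X\to Y$ of dendroidal sets is called normal if, for every tree $S$, the group $\mathrm{Aut}(S)$ acts freely on the complement of the image of $X_S$ in $Y_S$. **Proposition 1.1.** For every $n\ge 0$ and every object $T$ of $\Omega$, the canonical map $$(\partial\Delta[n]\otimes\Omega[T])\cup_{\partial\Delta[n]\otimes\partial\Omega[T]}(\Delta[n]\otimes\partial\Omega[T])\longrightarrow\Delta[n]\otimes\Omega[T]$$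 from the pushout is a normal monomorphism of dendroidal sets. -/

import Mathlib

open CategoryTheory

universe u v u₁ v₁ u₂ v₂ u₃ v₃ u₄ v₄

namespace Dendroidal

/-! ## Coloured symmetric operads in sets -/

/-- A coloured symmetric operad in sets. Operations `Op x c` have inputs indexed by an arbitrary
finite set `ι`, with colours `x : ι → Color`, and output colour `c`; the symmetric group actions
are encoded by reindexing along bijections of finite sets. -/
structure Operad where
  /-- The set of colours. -/
  Color : Type u
  /-- The operations with given input colours and given output colour. -/
  Op : {ι : Type} → [Finite ι] → (ι → Color) → Color → Type v
  /-- The unit operations. -/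
  id : (c : Color) → Op (fun _ : Unit => c) c
  /-- The (symmetric) action of bijections of the set of inputs. -/
  reindex : {ι κ : Type} → [Finite ι] → [Finite κ] → {x : ι → Color} → {c : Color} →
    (e : κ ≃ ι) → Op x c → Op (fun k => x (e k)) c
  /-- Operadic composition. -/
  comp : {ι : Type} → {κ : ι → Type} → [Finite ι] → [∀ i, Finite (κ i)] →
    {x : ι → Color} → {y : (i : ι) → κ i → Color} → {c : Color} →
    Op x c → ((i : ι) → Op (y i) (x i)) → Op (fun a : (Σ i, κ i) => y a.1 a.2) c
  reindex_refl : ∀ {ι : Type} [Finite ι] {x : ι → Color} {c : Color} (p : Op x c),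
    reindex (Equiv.refl ι) p = p
  reindex_reindex : ∀ {ι κ μ : Type} [Finite ι] [Finite κ] [Finite μ]
    {x : ι → Color} {c : Color} (e : κ ≃ ι) (e' : μ ≃ κ) (p : Op x c),
    reindex e' (reindex e p) = reindex (e'.trans e) p
  comp_reindex_left : ∀ {ι ι' : Type} {κ : ι → Type} [Finite ι] [Finite ι'] [∀ i, Finite (κ i)]
    {x : ι → Color} {y : (i : ι) → κ i → Color} {c : Color} (e : ι' ≃ ι)
    (p : Op x c) (q : (i : ι) → Op (y i) (x i)),
    comp (reindex e p) (fun i' => q (e i')) = reindex (Equiv.sigmaCongrLeft e) (comp p q)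
  comp_reindex_right : ∀ {ι : Type} {κ κ' : ι → Type} [Finite ι] [∀ i, Finite (κ i)]
    [∀ i, Finite (κ' i)] {x : ι → Color} {y : (i : ι) → κ i → Color} {c : Color}
    (e : (i : ι) → κ' i ≃ κ i) (p : Op x c) (q : (i : ι) → Op (y i) (x i)),
    comp p (fun i => reindex (e i) (q i)) = reindex (Equiv.sigmaCongrRight e) (comp p q)
  id_comp : ∀ {κ : Type} [Finite κ] {y : κ → Color} {c : Color} (q : Op y c),
    comp (id c) (fun _ => q) = reindex (Equiv.uniqueSigma (fun _ : Unit => κ)) q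
  comp_id : ∀ {ι : Type} [Finite ι] {x : ι → Color} {c : Color} (p : Op x c),
    comp p (fun i => id (x i)) = reindex (Equiv.sigmaUnique ι (fun _ => Unit)) p
  comp_assoc : ∀ {ι : Type} {κ : ι → Type} {μ : (i : ι) → κ i → Type} [Finite ι]
    [∀ i, Finite (κ i)] [∀ i k, Finite (μ i k)] {x : ι → Color} {y : (i : ι) → κ i → Color}
    {z : (i : ι) → (k : κ i) → μ i k → Color} {c : Color}
    (p : Op x c) (q : (i : ι) → Op (y i) (x i)) (r : (i : ι) → (k : κ i) → Op (z i k) (y i k)),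
    comp (comp p q) (fun a => r a.1 a.2) =
      reindex (Equiv.sigmaAssoc μ) (comp p (fun i => comp (q i) (r i)))

/-- A morphism of coloured symmetric operads. -/
@[ext]
structure Operad.Hom (P : Operad.{u₁, v₁}) (Q : Operad.{u₂, v₂}) where
  /-- The map on colours. -/
  color : P.Color → Q.Color
  /-- The map on operations. -/
  op : {ι : Type} → [Finite ι] → {x : ι → P.Color} → {c : P.Color} →
    P.Op x c → Q.Op (fun i => color (x i)) (color c)
  map_id : ∀ c : P.Color, op (P.id c) = Q.id (color c)
  map_reindex : ∀ {ι κ : Type} [Finite ι] [Finite κ] {x : ι → P.Color} {c : P.Color}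
    (e : κ ≃ ι) (p : P.Op x c), op (P.reindex e p) = Q.reindex e (op p)
  map_comp : ∀ {ι : Type} {κ : ι → Type} [Finite ι] [∀ i, Finite (κ i)]
    {x : ι → P.Color} {y : (i : ι) → κ i → P.Color} {c : P.Color}
    (p : P.Op x c) (q : (i : ι) → P.Op (y i) (x i)),
    op (P.comp p q) = Q.comp (op p) (fun i => op (q i))

/-- The identity morphism. -/
def Operad.Hom.refl (P : Operad.{u, v}) : Operad.Hom P P where
  color c := c
  op p := p
  map_id _ := rfl
  map_reindex _ _ := rfl
  map_comp _ _ := rfl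

/-- Composition of morphisms (in diagrammatic order). -/
def Operad.Hom.trans {P : Operad.{u₁, v₁}} {Q : Operad.{u₂, v₂}} {R : Operad.{u₃, v₃}}
    (f : Operad.Hom P Q) (g : Operad.Hom Q R) : Operad.Hom P R where
  color c := g.color (f.color c)
  op p := g.op (f.op p)
  map_id c := by rw [f.map_id, g.map_id]
  map_reindex e p := by rw [f.map_reindex, g.map_reindex]
  map_comp p q := by rw [f.map_comp, g.map_comp]

/-! ## The Boardman-Vogt tensor product -/

/-- Formal operations of the tensor product of `P` and `Q`: generated by the operations `p ⊗ d`
(`left p d`) and `c ⊗ q` (`right c q`), for colours `d` of `Q` and `c` of `P`, under units,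
reindexing and composition. -/
inductive BVTerm (P : Operad.{u₁, v₁}) (Q : Operad.{u₂, v₂}) :
    {ι : Type} → [Finite ι] → (ι → P.Color × Q.Color) → P.Color × Q.Color →
      Type (max 1 u₁ u₂ v₁ v₂)
  | left {ι : Type} [Finite ι] {x : ι → P.Color} {c : P.Color} (p : P.Op x c) (d : Q.Color) :
      BVTerm P Q (fun i => (x i, d)) (c, d)
  | right {κ : Type} [Finite κ] {y : κ → Q.Color} {d : Q.Color} (c : P.Color) (q : Q.Op y d) :
      BVTerm P Q (fun k => (c, y k)) (c, d)
  | id (z : P.Color × Q.Color) : BVTerm P Q (fun _ : Unit => z) z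
  | reindex {ι κ : Type} [Finite ι] [Finite κ] {x : ι → P.Color × Q.Color}
      {c : P.Color × Q.Color} (e : κ ≃ ι) (p : BVTerm P Q x c) :
      BVTerm P Q (fun k => x (e k)) c
  | comp {ι : Type} {κ : ι → Type} [Finite ι] [∀ i, Finite (κ i)]
      {x : ι → P.Color × Q.Color} {y : (i : ι) → κ i → P.Color × Q.Color}
      {c : P.Color × Q.Color} (p : BVTerm P Q x c) (q : (i : ι) → BVTerm P Q (y i) (x i)) :
      BVTerm P Q (fun a : (Σ i, κ i) => y a.1 a.2) c

/-- The exchange of the two factors of a product of finite sets, written as a sigma type. -/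
def sigmaSwap (ι κ : Type) : (Σ _ : ι, κ) ≃ (Σ _ : κ, ι) where
  toFun a := ⟨a.2, a.1⟩
  invFun a := ⟨a.2, a.1⟩
  left_inv _ := rfl
  right_inv _ := rfl

/-- The relations of the Boardman-Vogt tensor product: the smallest congruence such that
the operad axioms hold, each `p ↦ p ⊗ d` and each `q ↦ c ⊗ q` is a morphism of operads, and the
interchange relation between `p ⊗ -` and `- ⊗ q` holds. -/
inductive BVRel (P : Operad.{u₁, v₁}) (Q : Operad.{u₂, v₂}) :
    {ι : Type} → [Finite ι] → {x : ι → P.Color × Q.Color} → {c : P.Color × Q.Color} →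
      BVTerm P Q x c → BVTerm P Q x c → Prop
  -- equivalence relation
  | refl {ι : Type} [Finite ι] {x : ι → P.Color × Q.Color} {c : P.Color × Q.Color}
      (p : BVTerm P Q x c) : BVRel P Q p p
  | symm {ι : Type} [Finite ι] {x : ι → P.Color × Q.Color} {c : P.Color × Q.Color}
      {p p' : BVTerm P Q x c} : BVRel P Q p p' → BVRel P Q p' p
  | trans {ι : Type} [Finite ι] {x : ι → P.Color × Q.Color} {c : P.Color × Q.Color}
      {p p' p'' : BVTerm P Q x c} : BVRel P Q p p' → BVRel P Q p' p'' → BVRel P Q p p''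
  -- compatibility with the operad structure
  | reindex_congr {ι κ : Type} [Finite ι] [Finite κ] {x : ι → P.Color × Q.Color}
      {c : P.Color × Q.Color} (e : κ ≃ ι) {p p' : BVTerm P Q x c} :
      BVRel P Q p p' → BVRel P Q (.reindex e p) (.reindex e p')
  | comp_congr {ι : Type} {κ : ι → Type} [Finite ι] [∀ i, Finite (κ i)]
      {x : ι → P.Color × Q.Color} {y : (i : ι) → κ i → P.Color × Q.Color}
      {c : P.Color × Q.Color} {p p' : BVTerm P Q x c} {q q' : (i : ι) → BVTerm P Q (y i) (x i)} :
      BVRel P Q p p' → (∀ i, BVRel P Q (q i) (q' i)) → BVRel P Q (.comp p q) (.comp p' q')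
  -- the operad axioms
  | reindex_refl {ι : Type} [Finite ι] {x : ι → P.Color × Q.Color} {c : P.Color × Q.Color}
      (p : BVTerm P Q x c) : BVRel P Q (.reindex (Equiv.refl ι) p) p
  | reindex_reindex {ι κ μ : Type} [Finite ι] [Finite κ] [Finite μ]
      {x : ι → P.Color × Q.Color} {c : P.Color × Q.Color} (e : κ ≃ ι) (e' : μ ≃ κ)
      (p : BVTerm P Q x c) :
      BVRel P Q (.reindex e' (.reindex e p)) (.reindex (e'.trans e) p)
  | comp_reindex_left {ι ι' : Type} {κ : ι → Type} [Finite ι] [Finite ι'] [∀ i, Finite (κ i)]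
      {x : ι → P.Color × Q.Color} {y : (i : ι) → κ i → P.Color × Q.Color}
      {c : P.Color × Q.Color} (e : ι' ≃ ι) (p : BVTerm P Q x c)
      (q : (i : ι) → BVTerm P Q (y i) (x i)) :
      BVRel P Q (.comp (.reindex e p) (fun i' => q (e i')))
        (.reindex (Equiv.sigmaCongrLeft e) (.comp p q))
  | comp_reindex_right {ι : Type} {κ κ' : ι → Type} [Finite ι] [∀ i, Finite (κ i)]
      [∀ i, Finite (κ' i)] {x : ι → P.Color × Q.Color} {y : (i : ι) → κ i → P.Color × Q.Color}
      {c : P.Color × Q.Color} (e : (i : ι) → κ' i ≃ κ i) (p : BVTerm P Q x c)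
      (q : (i : ι) → BVTerm P Q (y i) (x i)) :
      BVRel P Q (.comp p (fun i => .reindex (e i) (q i)))
        (.reindex (Equiv.sigmaCongrRight e) (.comp p q))
  | id_comp {κ : Type} [Finite κ] {y : κ → P.Color × Q.Color} {c : P.Color × Q.Color}
      (q : BVTerm P Q y c) :
      BVRel P Q (.comp (.id c) (fun _ => q))
        (.reindex (Equiv.uniqueSigma (fun _ : Unit => κ)) q)
  | comp_id {ι : Type} [Finite ι] {x : ι → P.Color × Q.Color} {c : P.Color × Q.Color}
      (p : BVTerm P Q x c) :
      BVRel P Q (.comp p (fun i => .id (x i)))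
        (.reindex (Equiv.sigmaUnique ι (fun _ => Unit)) p)
  | comp_assoc {ι : Type} {κ : ι → Type} {μ : (i : ι) → κ i → Type} [Finite ι]
      [∀ i, Finite (κ i)] [∀ i k, Finite (μ i k)] {x : ι → P.Color × Q.Color}
      {y : (i : ι) → κ i → P.Color × Q.Color}
      {z : (i : ι) → (k : κ i) → μ i k → P.Color × Q.Color} {c : P.Color × Q.Color}
      (p : BVTerm P Q x c) (q : (i : ι) → BVTerm P Q (y i) (x i))
      (r : (i : ι) → (k : κ i) → BVTerm P Q (z i k) (y i k)) :
      BVRel P Q (.comp (.comp p q) (fun a => r a.1 a.2))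
        (.reindex (Equiv.sigmaAssoc μ) (.comp p (fun i => .comp (q i) (r i))))
  -- `p ↦ p ⊗ d` is a morphism of operads
  | left_id (c : P.Color) (d : Q.Color) : BVRel P Q (.left (P.id c) d) (.id (c, d))
  | left_reindex {ι κ : Type} [Finite ι] [Finite κ] {x : ι → P.Color} {c : P.Color}
      (e : κ ≃ ι) (p : P.Op x c) (d : Q.Color) :
      BVRel P Q (.left (P.reindex e p) d) (.reindex e (.left p d))
  | left_comp {ι : Type} {κ : ι → Type} [Finite ι] [∀ i, Finite (κ i)]
      {x : ι → P.Color} {y : (i : ι) → κ i → P.Color} {c : P.Color}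
      (p : P.Op x c) (q : (i : ι) → P.Op (y i) (x i)) (d : Q.Color) :
      BVRel P Q (.left (P.comp p q) d) (.comp (.left p d) (fun i => .left (q i) d))
  -- `q ↦ c ⊗ q` is a morphism of operads
  | right_id (c : P.Color) (d : Q.Color) : BVRel P Q (.right c (Q.id d)) (.id (c, d))
  | right_reindex {ι κ : Type} [Finite ι] [Finite κ] {y : ι → Q.Color} {d : Q.Color}
      (e : κ ≃ ι) (c : P.Color) (q : Q.Op y d) :
      BVRel P Q (.right c (Q.reindex e q)) (.reindex e (.right c q))
  | right_comp {ι : Type} {κ : ι → Type} [Finite ι] [∀ i, Finite (κ i)]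
      {x : ι → Q.Color} {y : (i : ι) → κ i → Q.Color} {d : Q.Color} (c : P.Color)
      (p : Q.Op x d) (q : (i : ι) → Q.Op (y i) (x i)) :
      BVRel P Q (.right c (Q.comp p q)) (.comp (.right c p) (fun i => .right c (q i)))
  -- the interchange relation
  | interchange {ι κ : Type} [Finite ι] [Finite κ] {x : ι → P.Color} {c : P.Color}
      {y : κ → Q.Color} {d : Q.Color} (p : P.Op x c) (q : Q.Op y d) :
      BVRel P Q (.comp (.left p d) (fun i => .right (x i) q))
        (.reindex (sigmaSwap ι κ) (.comp (.right c q) (fun k => .left p (y k))))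

/-- The operations of the Boardman-Vogt tensor product, as a quotient of formal operations. -/
instance BVSetoid (P : Operad.{u₁, v₁}) (Q : Operad.{u₂, v₂}) {ι : Type} [Finite ι]
    (x : ι → P.Color × Q.Color) (c : P.Color × Q.Color) : Setoid (BVTerm P Q x c) where
  r := BVRel P Q
  iseqv := ⟨BVRel.refl, BVRel.symm, BVRel.trans⟩

/-- The Boardman-Vogt tensor product of two coloured symmetric operads. -/
noncomputable def BV (P : Operad.{u₁, v₁}) (Q : Operad.{u₂, v₂}) :
    Operad.{max u₁ u₂, max 1 u₁ u₂ v₁ v₂} where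
  Color := P.Color × Q.Color
  Op x c := Quotient (BVSetoid P Q x c)
  id z := Quotient.mk _ (.id z)
  reindex e := Quotient.map (.reindex e) (fun _ _ h => .reindex_congr e h)
  comp p q := Quotient.mk _ (.comp p.out (fun i => (q i).out))
  reindex_refl p := by
    induction p using Quotient.inductionOn with | _ p => exact Quotient.sound (.reindex_refl p)
  reindex_reindex e e' p := by
    induction p using Quotient.inductionOn with
    | _ p => exact Quotient.sound (.reindex_reindex e e' p)
  comp_reindex_left e p q := by
    induction p using Quotient.inductionOn with
    | _ p =>
      refine Quotient.sound (.trans (.comp_congr ?_ (fun i => .refl _))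
        (.trans (.comp_reindex_left e p (fun i => (q i).out)) (.reindex_congr _ ?_)))
      · exact Quotient.mk_out (BVTerm.reindex e p)
      · exact .comp_congr (.symm (Quotient.mk_out p)) (fun i => .refl _)
  comp_reindex_right e p q := by
    refine Quotient.sound (.trans (.comp_congr (.refl _) (fun i => ?_))
      (.comp_reindex_right e p.out (fun i => (q i).out)))
    refine Quotient.exact (s := BVSetoid P Q _ _) ((Quotient.out_eq _).trans ?_)
    change Quotient.map _ _ (q i) = _
    conv_lhs => rw [← Quotient.out_eq (q i)]
    rfl
  id_comp q := by
    induction q using Quotient.inductionOn with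
    | _ q =>
      exact Quotient.sound (.trans
        (.comp_congr (Quotient.mk_out (BVTerm.id _)) (fun _ => Quotient.mk_out q)) (.id_comp q))
  comp_id p := by
    induction p using Quotient.inductionOn with
    | _ p =>
      exact Quotient.sound (.trans
        (.comp_congr (Quotient.mk_out p) (fun i => Quotient.mk_out (BVTerm.id _))) (.comp_id p))
  comp_assoc p q r := by
    refine Quotient.sound (.trans (.comp_congr (Quotient.mk_out (BVTerm.comp p.out _))
      (fun _ => .refl _)) (.trans (.comp_assoc p.out (fun i => (q i).out)
      (fun i k => (r i k).out)) (.reindex_congr _ (.comp_congr (.refl _) (fun i => .symm ?_)))))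
    exact Quotient.mk_out (BVTerm.comp (q i).out _)

/-- The map on formal operations induced by a pair of morphisms of operads. -/
def BVTerm.map {P : Operad.{u₁, v₁}} {Q : Operad.{u₂, v₂}} {P' : Operad.{u₃, v₃}}
    {Q' : Operad.{u₄, v₄}} (f : Operad.Hom P P') (g : Operad.Hom Q Q') :
    {ι : Type} → [Finite ι] → {x : ι → P.Color × Q.Color} → {c : P.Color × Q.Color} →
      BVTerm P Q x c →
      BVTerm P' Q' (fun i => (f.color (x i).1, g.color (x i).2)) (f.color c.1, g.color c.2)
  | _, _, _, _, @BVTerm.left _ _ _ _ _ _ p d => .left (f.op p) (g.color d)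
  | _, _, _, _, @BVTerm.right _ _ _ _ _ _ c q => .right (f.color c) (g.op q)
  | _, _, _, _, @BVTerm.id _ _ z => .id (f.color z.1, g.color z.2)
  | _, _, _, _, @BVTerm.reindex _ _ _ _ _ _ _ _ e p => .reindex e (BVTerm.map f g p)
  | _, _, _, _, @BVTerm.comp _ _ _ _ _ _ _ _ _ p q =>
      .comp (BVTerm.map f g p) (fun i => BVTerm.map f g (q i))

theorem BVRel.map {P : Operad.{u₁, v₁}} {Q : Operad.{u₂, v₂}} {P' : Operad.{u₃, v₃}}
    {Q' : Operad.{u₄, v₄}} (f : Operad.Hom P P') (g : Operad.Hom Q Q')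
    {ι : Type} [Finite ι] {x : ι → P.Color × Q.Color} {c : P.Color × Q.Color}
    {p p' : BVTerm P Q x c} (h : BVRel P Q p p') : BVRel P' Q' (p.map f g) (p'.map f g) := by
  induction h with
  | refl p => exact .refl _
  | symm _ ih => exact .symm ih
  | trans _ _ ih ih' => exact .trans ih ih'
  | reindex_congr e _ ih => exact .reindex_congr e ih
  | comp_congr _ _ ih ih' => exact .comp_congr ih ih'
  | reindex_refl p => exact .reindex_refl _
  | reindex_reindex e e' p => exact .reindex_reindex e e' _
  | comp_reindex_left e p q => exact .comp_reindex_left e _ (fun i => (q i).map f g)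
  | comp_reindex_right e p q => exact .comp_reindex_right e _ (fun i => (q i).map f g)
  | id_comp q => exact .id_comp _
  | comp_id p => exact .comp_id _
  | comp_assoc p q r =>
    exact .comp_assoc _ (fun i => (q i).map f g) (fun i k => (r i k).map f g)
  | left_id c d => simp only [BVTerm.map, f.map_id]; exact .left_id _ _
  | left_reindex e p d => simp only [BVTerm.map, f.map_reindex]; exact .left_reindex e _ _
  | left_comp p q d => simp only [BVTerm.map, f.map_comp]; exact .left_comp _ _ _
  | right_id c d => simp only [BVTerm.map, g.map_id]; exact .right_id _ _
  | right_reindex e c q => simp only [BVTerm.map, g.map_reindex]; exact .right_reindex e _ _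
  | right_comp c p q => simp only [BVTerm.map, g.map_comp]; exact .right_comp _ _ _
  | interchange p q => exact .interchange (f.op p) (g.op q)

/-- Functoriality of the Boardman-Vogt tensor product. -/
noncomputable def BV.map {P : Operad.{u₁, v₁}} {Q : Operad.{u₂, v₂}} {P' : Operad.{u₃, v₃}}
    {Q' : Operad.{u₄, v₄}} (f : Operad.Hom P P') (g : Operad.Hom Q Q') :
    Operad.Hom (BV P Q) (BV P' Q') where
  color z := (f.color z.1, g.color z.2)
  op := Quotient.map (BVTerm.map f g) (fun _ _ h => BVRel.map f g h)
  map_id _ := rfl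
  map_reindex e p := by induction p using Quotient.inductionOn with | _ p => rfl
  map_comp p q := by
    refine Quotient.sound (.comp_congr ?_ (fun i => ?_))
    · refine Quotient.exact (s := BVSetoid P' Q' _ _) (Eq.trans ?_ (Quotient.out_eq _).symm)
      conv_rhs => rw [← Quotient.out_eq p]
      rfl
    · refine Quotient.exact (s := BVSetoid P' Q' _ _) (Eq.trans ?_ (Quotient.out_eq _).symm)
      change _ = Quotient.map _ _ (q i)
      conv_rhs => rw [← Quotient.out_eq (q i)]
      rfl

/-! ## Trees and dendroidal sets -/

/-- A finite rooted tree, given by its finite set of edges, ordered so that the root is the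
smallest edge, and its set of leaves, which are maximal edges. Every edge `e` that is not a leaf
is the output of exactly one vertex, whose inputs are the edges covering `e`; a maximal edge that
is not a leaf thus carries a vertex without inputs (a stump). -/
structure Tree where
  /-- The edges. -/
  Edge : Type
  [finite : Finite Edge]
  [order : PartialOrder Edge]
  /-- The root edge. -/
  root : Edge
  root_le : ∀ e : Edge, root ≤ e
  /-- The edges below a given edge form a chain. -/
  chain : ∀ {a b e : Edge}, a ≤ e → b ≤ e → a ≤ b ∨ b ≤ a
  /-- The leaves. -/
  leaves : Set Edge
  leaf_max : ∀ {l e : Edge}, l ∈ leaves → l ≤ e → e = l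

attribute [instance] Tree.finite Tree.order

/-- There is a subtree of `T` with root `c` whose leaves are, bijectively, the edges `x i`: all
`x i` lie above `c`, they are pairwise incomparable, and every leaf of `T` above `c` lies above
one of them. (Such a subtree is unique: its edges are those `e` with `c ≤ e` and not `x i < e`
for any `i`, and it has all the vertices of `T` on those of its edges that are not among
the `x i`.) -/
structure Tree.IsSubtree (T : Tree) {ι : Type} (x : ι → T.Edge) (c : T.Edge) : Prop where
  le : ∀ i, c ≤ x i
  incomparable : ∀ i j, x i ≤ x j → i = j
  leaf : ∀ l ∈ T.leaves, c ≤ l → ∃ i, x i ≤ l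

/-- The operad `Ω(T)`, the free operad generated by the vertices of `T`: its colours are the edges
of `T`, and there is one operation from `x` to `c` if there is a subtree with leaves `x` and
root `c`, and none otherwise. -/
def Tree.operad (T : Tree) : Operad.{0, 0} where
  Color := T.Edge
  Op x c := PLift (T.IsSubtree x c)
  id c := ⟨⟨fun _ => le_rfl, fun _ _ _ => rfl, fun _ _ h => ⟨(), h⟩⟩⟩
  reindex e p := ⟨⟨fun k => p.down.le _, fun k k' h => e.injective (p.down.incomparable _ _ h),
    fun l hl h => by
      obtain ⟨i, hi⟩ := p.down.leaf l hl h
      exact ⟨e.symm i, by simpa using hi⟩⟩⟩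
  comp {ι κ _ _ x y c} p q := ⟨⟨fun a => (p.down.le _).trans ((q a.1).down.le _), by
      rintro ⟨i, j⟩ ⟨i', j'⟩ h
      have h' : y i j ≤ y i' j' := h
      have hi : i = i' := by
        rcases T.chain (((q i).down.le j).trans h') ((q i').down.le j') with h1 | h1
        · exact p.down.incomparable _ _ h1
        · exact (p.down.incomparable _ _ h1).symm
      subst hi
      have hj := (q i).down.incomparable _ _ h'
      subst hj
      rfl,
    fun l hl h => by
      obtain ⟨i, hi⟩ := p.down.leaf l hl h
      obtain ⟨j, hj⟩ := (q i).down.leaf l hl hi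
      exact ⟨⟨i, j⟩, hj⟩⟩⟩
  reindex_refl _ := rfl
  reindex_reindex _ _ _ := rfl
  comp_reindex_left _ _ _ := rfl
  comp_reindex_right _ _ _ := rfl
  id_comp _ := rfl
  comp_id _ := rfl
  comp_assoc _ _ _ := rfl

/-- The category `Ω` of trees: morphisms `S ⟶ T` are the morphisms of operads
`Ω(S) → Ω(T)`. -/
instance : Category.{1} Tree where
  Hom S T := Operad.Hom S.operad T.operad
  id S := Operad.Hom.refl S.operad
  comp f g := Operad.Hom.trans f g

/-- The linear tree `[n]` with edges `0 < 1 < ⋯ < n`, root `0` and the unique leaf `n`. -/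
def linearTree (n : ℕ) : Tree where
  Edge := Fin (n + 1)
  root := 0
  root_le := Fin.zero_le
  chain _ _ := le_total _ _
  leaves := {Fin.last n}
  leaf_max {l e} hl h := by
    obtain rfl : l = Fin.last n := hl
    exact le_antisymm (Fin.le_last e) h

/-- Dendroidal sets: presheaves of sets on the category of trees. -/
abbrev DSet := Treeᵒᵖ ⥤ Type 1

/-- The representable dendroidal set `Ω[T]`. -/
abbrev representable (T : Tree) : DSet := yoneda.obj T

/-- The subobject `∂Ω[T]` of `Ω[T]`: the union of the images of all proper faces of `T`, that is,
of all monomorphisms `R ⟶ T` of trees which are not isomorphisms. -/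
def boundary (T : Tree) : Subfunctor (representable T) where
  obj S := {f : S.unop ⟶ T |
    ∃ (R : Tree) (i : R ⟶ T) (g : S.unop ⟶ R), Mono i ∧ ¬ IsIso i ∧ g ≫ i = f}
  map := by
    rintro U V a f ⟨R, i, g, hi, hi', rfl⟩
    exact ⟨R, i, a.unop ≫ g, hi, hi', Category.assoc _ _ _⟩

/-- The boundary inclusion `∂Ω[T] → Ω[T]`. -/
abbrev boundaryInclusion (T : Tree) : (boundary T).toFunctor ⟶ representable T :=
  (boundary T).ι

/-- A generator of the tensor product `X ⊗ Y` in degree `R`: elements `x ∈ X(S)` and `y ∈ Y(T)`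
together with an element of degree `R` of the nerve of `Ω(S) ⊗ Ω(T)`. -/
structure TensorCell (X Y : DSet) (R : Tree) where
  /-- The first tree. -/
  S : Tree
  /-- The second tree. -/
  T : Tree
  /-- The dendrex of `X`. -/
  x : X.obj (.op S)
  /-- The dendrex of `Y`. -/
  y : Y.obj (.op T)
  /-- The dendrex of the nerve of `Ω(S) ⊗ Ω(T)`. -/
  φ : Operad.Hom R.operad (BV S.operad T.operad)

/-- The identifications defining the tensor product of dendroidal sets. -/
inductive TensorRel (X Y : DSet) (R : Tree) : TensorCell X Y R → TensorCell X Y R → Prop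
  | mk {S S' T T' : Tree} (a : S ⟶ S') (b : T ⟶ T') (x : X.obj (.op S')) (y : Y.obj (.op T'))
      (φ : Operad.Hom R.operad (BV S.operad T.operad)) :
      TensorRel X Y R ⟨S, T, X.map a.op x, Y.map b.op y, φ⟩ ⟨S', T', x, y, φ.trans (BV.map a b)⟩

/-- The tensor product of dendroidal sets
`X ⊗ Y = colim_{Ω[S] → X, Ω[T] → Y} N(Ω(S) ⊗ Ω(T))`, where `N(P)(R) = Hom(Ω(R), P)` is the
dendroidal nerve of an operad `P`: the extension by colimits in both variables of
`Ω[S] ⊗ Ω[T] = N(Ω(S) ⊗ Ω(T))`. -/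
noncomputable def tensorObj (X Y : DSet) : DSet where
  obj R := Quot (TensorRel X Y R.unop)
  map {R R'} r := TypeCat.ofHom (Quot.map
    (fun u => ⟨u.S, u.T, u.x, u.y, Operad.Hom.trans r.unop u.φ⟩)
    (by rintro _ _ ⟨a, b, x, y, φ⟩; exact .mk a b x y _))
  map_id R := by ext u; induction u using Quot.ind; rfl
  map_comp r r' := by ext u; induction u using Quot.ind; rfl

/-- Functoriality of the tensor product of dendroidal sets. -/
noncomputable def tensorMap {X X' Y Y' : DSet} (f : X ⟶ X') (g : Y ⟶ Y') :
    tensorObj X Y ⟶ tensorObj X' Y' where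
  app R := TypeCat.ofHom (Quot.map
    (fun u => ⟨u.S, u.T, f.app _ u.x, g.app _ u.y, u.φ⟩)
    (by
      rintro _ _ ⟨a, b, x, y, φ⟩
      simp only [NatTrans.naturality_apply]
      exact .mk a b _ _ φ))
  naturality R R' r := by ext u; induction u using Quot.ind; rfl

theorem tensorMap_comm {X X' Y Y' : DSet} (f : X ⟶ X') (g : Y ⟶ Y') :
    tensorMap (𝟙 X) g ≫ tensorMap f (𝟙 Y') = tensorMap f (𝟙 Y) ≫ tensorMap (𝟙 X') g := by
  ext R u; induction u using Quot.ind; rfl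

/-- For `f : A ⟶ X` and `g : B ⟶ Y`, the canonical map from the pushout
`(A ⊗ Y) ∪_{A ⊗ B} (X ⊗ B)` to `X ⊗ Y`. -/
noncomputable def pushoutTensor {A X B Y : DSet} (f : A ⟶ X) (g : B ⟶ Y) :
    Limits.pushout (tensorMap (𝟙 A) g) (tensorMap f (𝟙 B)) ⟶ tensorObj X Y :=
  Limits.pushout.desc (tensorMap f (𝟙 Y)) (tensorMap (𝟙 X) g) (tensorMap_comm f g)

/-- A normal monomorphism of dendroidal sets: a monomorphism `f : X ⟶ Y` such that for every tree
`S` the group of automorphisms of `S` acts freely on the complement of the image of `X(S)`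
in `Y(S)`. -/
def IsNormalMono {X Y : DSet} (f : X ⟶ Y) : Prop :=
  Mono f ∧ ∀ (S : Tree) (y : Y.obj (.op S)), y ∉ Set.range (f.app (.op S)) →
    ∀ a : S ≅ S, Y.map a.hom.op y = y → a = Iso.refl S

end Dendroidal

namespace Dendroidal

/-! ## Trees -/

/-! Everything in sight is determined by maps on edges. Let `S` be linear. In the Boardman–Vogt
product of `Ω(S)` and `Ω(T)`, interchange moves the unary operations of `S` past those of `T`
towards the inputs. Every operation is thus an operation of `T` followed, at its inputs, by unary
operations of `S` (`BV.isNormal`). Since `Ω(S)` and `Ω(T)` have at most one operation for given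
inputs and output, so has their product (`BV.isThin`). A dendrex of shape `R` is therefore a pair
consisting of a monotone map from the edges of `R` to those of `S` and a morphism of trees `R ⟶ T`.

Consequently, if `X → Δ[n]` and `Y → Ω[T]` are injective and `X` is closed under images, each
element of `X ⊗ Y` of shape `R` has a canonical representative (`exists_graph`): the image in `[n]`
of its first component `k`, a dendrex of `Y` of shape `R`, and the graph of `k`. Hence `X ⊗ Y`
embeds into maps of edges `R → [n] × T`. Moreover, an element of `∂Δ[n] ⊗ Ω[T]` and one of `Δ[n] ⊗
∂Ω[T]` with the same edge map come from a common element of `∂Δ[n] ⊗ ∂Ω[T]`, so the pushout also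
embeds.

For normality, an automorphism `a` fixing an element satisfies `f ∘ a = f` for its second component
`f : S ⟶ T`. Morphisms of trees identify only comparable edges, and an automorphism of a finite
poset fixes each element comparable to its image, so `a` is the identity. -/

instance Tree.subsingleton_op (T : Tree) {ι : Type} [Finite ι] (x : ι → T.operad.Color)
    (c : T.operad.Color) : Subsingleton (T.operad.Op x c) :=
  inferInstanceAs (Subsingleton (PLift (T.IsSubtree x c)))

/-- An operad in which an operation is determined by its inputs and its output. -/
structure Operad.IsThin (P : Operad.{u, v}) : Prop where
  eq : ∀ {ι : Type} [Finite ι] {x : ι → P.Color} {c : P.Color} (p q : P.Op x c), p = q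

theorem Tree.operad_isThin (T : Tree) : T.operad.IsThin := ⟨Subsingleton.elim⟩

theorem Operad.IsThin.hom_ext {P : Operad.{u₁, v₁}} {Q : Operad.{u₂, v₂}} (hQ : Q.IsThin)
    {f g : Operad.Hom P Q} (h : ∀ c, f.color c = g.color c) : f = g := by
  obtain ⟨fc, fo, _, _, _⟩ := f
  obtain ⟨gc, go, _, _, _⟩ := g
  obtain rfl : fc = gc := funext h
  congr
  funext ι _ x c p
  exact hQ.eq _ _

/-- A morphism into a thin operad is determined by a map on colours under which operations have an
image. -/
noncomputable def Operad.IsThin.hom {P : Operad.{u₁, v₁}} {Q : Operad.{u₂, v₂}} (hQ : Q.IsThin)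
    (f : P.Color → Q.Color)
    (hf : ∀ {ι : Type} [Finite ι] {x : ι → P.Color} {c : P.Color}, P.Op x c →
      Nonempty (Q.Op (fun i => f (x i)) (f c))) : Operad.Hom P Q where
  color := f
  op p := (hf p).some
  map_id _ := hQ.eq _ _
  map_reindex _ _ := hQ.eq _ _
  map_comp _ _ := hQ.eq _ _

/-- The map on edges underlying a morphism of trees. -/
def Tree.edgeMap {S T : Tree} (f : S ⟶ T) : S.Edge → T.Edge := Operad.Hom.color f

theorem Tree.hom_ext {S T : Tree} {f g : S ⟶ T} (h : ∀ e, edgeMap f e = edgeMap g e) : f = g :=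
  T.operad_isThin.hom_ext h

/-- The morphism of trees given by a map on edges which preserves subtrees. -/
noncomputable def Tree.homMk {S T : Tree} (f : S.Edge → T.Edge)
    (hf : ∀ {ι : Type} [Finite ι] {x : ι → S.Edge} {c : S.Edge}, S.IsSubtree x c →
      T.IsSubtree (fun i => f (x i)) (f c)) : S ⟶ T :=
  T.operad_isThin.hom (P := S.operad) f (fun p => ⟨⟨hf p.down⟩⟩)

theorem Tree.isSubtree_map {S T : Tree} (f : S ⟶ T) {ι : Type} [Finite ι] {x : ι → S.Edge}
    {c : S.Edge} (h : S.IsSubtree x c) :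
    T.IsSubtree (fun i => edgeMap f (x i)) (edgeMap f c) :=
  (Operad.Hom.op f (ι := ι) (x := x) (c := c) ⟨h⟩).down

/-- An antichain above `c` can be completed to the leaves of a subtree with root `c`. -/
theorem Tree.isSubtree_of_antichain (T : Tree) (c : T.Edge) (s : Set T.Edge)
    (hc : ∀ a ∈ s, c ≤ a) (hs : IsAntichain (· ≤ ·) s) :
    T.IsSubtree (Subtype.val :
      {e // e ∈ s ∨ (e ∈ T.leaves ∧ c ≤ e ∧ ∀ a ∈ s, ¬ a ≤ e)} → T.Edge) c where
  le i := i.2.elim (hc _) (fun h => h.2.1)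
  incomparable := by
    rintro ⟨i, hi⟩ ⟨j, hj⟩ (h : i ≤ j)
    apply Subtype.ext
    change i = j
    rcases hi with hi | hi
    · rcases hj with hj | hj
      · exact hs.eq hi hj h
      · exact absurd h (hj.2.2 _ hi)
    · exact (T.leaf_max hi.1 h).symm
  leaf l hl h := by
    by_cases h' : ∃ a ∈ s, a ≤ l
    · obtain ⟨a, ha, hal⟩ := h'
      exact ⟨⟨a, .inl ha⟩, hal⟩
    · push Not at h'
      exact ⟨⟨l, .inr ⟨hl, h, h'⟩⟩, le_rfl⟩

/-- Some subtree with root `a` has `b` among its leaves, and its image is again a subtree. -/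
theorem Tree.hom_monotone {S T : Tree} (f : S ⟶ T) : Monotone (edgeMap f) := by
  intro a b h
  have := S.isSubtree_of_antichain a {b} (by simpa using h) (by simp)
  exact (isSubtree_map f this).le ⟨b, .inl rfl⟩

/-- Incomparable edges are two distinct leaves of one subtree, and the leaves of its image are again
pairwise incomparable. -/
theorem Tree.comparable_of_hom {S T : Tree} (f : S ⟶ T) {a b : S.Edge}
    (h : edgeMap f a ≤ edgeMap f b) : a ≤ b ∨ b ≤ a := by
  by_contra! hab
  have := S.isSubtree_of_antichain S.root {a, b} (fun _ _ => S.root_le _) (by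
    rintro x (rfl | rfl) y (rfl | rfl) hxy
    · exact absurd rfl hxy
    · exact hab.1
    · exact hab.2
    · exact absurd rfl hxy)
  have h' := (isSubtree_map f this).incomparable ⟨a, .inl (.inl rfl)⟩ ⟨b, .inl (.inr rfl)⟩ h
  exact hab.1 (congrArg Subtype.val h').le

/-- From `a ≤ σ a` the powers of `σ` give an increasing chain starting at `a`, which returns to `a`
because `σ` has finite order; dually for `σ a ≤ a`. -/
theorem eq_of_orderIso_comparable {α : Type*} [PartialOrder α] [Finite α] (σ : α ≃o α) {a : α}
    (h : a ≤ σ a ∨ σ a ≤ a) : σ a = a := by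
  have key (n : ℕ) : (a ≤ σ a → a ≤ (σ ^ n) a) ∧ (σ a ≤ a → (σ ^ n) a ≤ a) := by
    induction n with
    | zero => exact ⟨fun _ => le_rfl, fun _ => le_rfl⟩
    | succ n ih =>
      rw [pow_succ']
      exact ⟨fun h => h.trans (σ.monotone (ih.1 h)), fun h => (σ.monotone (ih.2 h)).trans h⟩
  have : Finite (α ≃o α) := DFunLike.finite _
  obtain ⟨n, hn, h1⟩ := (isOfFinOrder_of_finite σ).exists_pow_eq_one
  obtain ⟨n, rfl⟩ := Nat.exists_eq_succ_of_ne_zero hn.ne'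
  have h2 : σ ((σ ^ n) a) = a := by
    rw [pow_succ'] at h1
    exact DFunLike.congr_fun h1 a
  rcases h with h | h
  · exact le_antisymm ((σ.monotone ((key n).1 h)).trans h2.le) h
  · exact le_antisymm h (h2.ge.trans (σ.monotone ((key n).2 h)))

/-- The automorphism group of a tree acts freely on the morphisms out of it. -/
theorem Tree.iso_eq_refl_of_comp {S T : Tree} (f : S ⟶ T) (a : S ≅ S)
    (h : ∀ e, edgeMap f (edgeMap a.hom e) = edgeMap f e) : a = Iso.refl S := by
  have h1 (e : S.Edge) : edgeMap a.inv (edgeMap a.hom e) = e :=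
    congrFun (congrArg Operad.Hom.color a.hom_inv_id) e
  have h2 (e : S.Edge) : edgeMap a.hom (edgeMap a.inv e) = e :=
    congrFun (congrArg Operad.Hom.color a.inv_hom_id) e
  let σ : S.Edge ≃o S.Edge :=
    { toFun := edgeMap a.hom
      invFun := edgeMap a.inv
      left_inv := h1
      right_inv := h2
      map_rel_iff' := by
        intro x y
        refine ⟨fun h => ?_, fun h => hom_monotone a.hom h⟩
        have := hom_monotone a.inv h
        exact (h1 x).symm.le.trans (this.trans (h1 y).le) }
  ext1
  refine hom_ext fun e => eq_of_orderIso_comparable σ ?_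
  exact (comparable_of_hom f (a := e) (b := σ e) (h e).ge)

/-! ## Linear trees -/

/-- The linear tree whose edges are the elements of a nonempty subset `s` of `{0, …, n}`. -/
noncomputable def subLinearTree {n : ℕ} (s : Set (Fin (n + 1))) (hs : s.Nonempty) : Tree where
  Edge := s
  root := ⟨wellFounded_lt.min s hs, wellFounded_lt.min_mem s hs⟩
  root_le e := not_lt.1 (wellFounded_lt.not_lt_min s e.2)
  chain _ _ := le_total _ _
  leaves := {e | ∀ e', e' ≤ e}
  leaf_max h h' := le_antisymm (h _) h'

/-- A tree whose subtrees are the intervals of its edges. -/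
structure Tree.IsLinear (S : Tree) : Prop where
  isSubtree_iff : ∀ {ι : Type} [Finite ι] {x : ι → S.Edge} {c : S.Edge},
    S.IsSubtree x c ↔ Nonempty (Unique ι) ∧ ∀ i, c ≤ x i

/-- The leaf is the top edge. It forces a subtree to have an input, excluding stumps, and totality
excludes two incomparable inputs. -/
theorem Tree.isLinear_of_total {S : Tree} (h : ∀ a b : S.Edge, a ≤ b ∨ b ≤ a)
    {l : S.Edge} (hl : l ∈ S.leaves) : S.IsLinear where
  isSubtree_iff {ι _ x c} := by
    have hle (e : S.Edge) : e ≤ l := (h e l).elim id fun h => (S.leaf_max hl h).le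
    refine ⟨fun hx => ⟨?_, hx.le⟩, fun ⟨⟨_⟩, hx⟩ => ⟨hx, fun _ _ _ => Subsingleton.elim _ _, ?_⟩⟩
    · obtain ⟨i, hi⟩ := hx.leaf l hl (hle c)
      exact ⟨⟨⟨i⟩, fun j => (h (x j) (x i)).elim (hx.incomparable _ _)
        fun h => (hx.incomparable _ _ h).symm⟩⟩
    · intro m hm _
      exact ⟨default, (h _ _).elim id fun h => (S.leaf_max hm h).le⟩

theorem linearTree_isLinear (n : ℕ) : (linearTree n).IsLinear :=
  Tree.isLinear_of_total (fun a b => le_total (α := Fin (n + 1)) a b) (l := Fin.last n) rfl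

theorem subLinearTree_isLinear {n : ℕ} (s : Set (Fin (n + 1))) (hs : s.Nonempty) :
    (subLinearTree s hs).IsLinear := by
  obtain ⟨m, hm, h⟩ := s.exists_max_image id s.toFinite hs
  exact Tree.isLinear_of_total (S := subLinearTree s hs) (fun a b => le_total (α := s) a b)
    (l := ⟨m, hm⟩) (fun e => h e.1 e.2)

/-- The inclusion between linear trees with edges in `{0, …, n}`. -/
noncomputable def subLinearTree.map {n : ℕ} {s t : Set (Fin (n + 1))} (hs : s.Nonempty)
    (ht : t.Nonempty) (h : s ⊆ t) : subLinearTree s hs ⟶ subLinearTree t ht :=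
  Tree.homMk (S := subLinearTree s hs) (T := subLinearTree t ht) (Set.inclusion h) fun hx =>
    (subLinearTree_isLinear t ht).isSubtree_iff.2 ((subLinearTree_isLinear s hs).isSubtree_iff.1 hx)

/-- The inclusion of the linear tree with edges in `s` into `[n]`. -/
noncomputable def subLinearTree.incl {n : ℕ} (s : Set (Fin (n + 1))) (hs : s.Nonempty) :
    subLinearTree s hs ⟶ linearTree n :=
  Tree.homMk (S := subLinearTree s hs) (T := linearTree n) Subtype.val fun hx =>
    (linearTree_isLinear n).isSubtree_iff.2 ((subLinearTree_isLinear s hs).isSubtree_iff.1 hx)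

/-- The corestriction of a morphism to `[n]` to a set of edges containing its image. -/
noncomputable def subLinearTree.lift {n : ℕ} {S : Tree} (x : S ⟶ linearTree n)
    (s : Set (Fin (n + 1))) (hs : s.Nonempty) (h : ∀ e, Tree.edgeMap x e ∈ s) :
    S ⟶ subLinearTree s hs :=
  Tree.homMk (T := subLinearTree s hs) (fun e => ⟨Tree.edgeMap x e, h e⟩) fun hx =>
    (subLinearTree_isLinear s hs).isSubtree_iff.2
      ((linearTree_isLinear n).isSubtree_iff.1 (Tree.isSubtree_map x hx))

/-! ## The boundary of a simplex -/

/-- Edges of `S` are morphisms from the tree `[0]`, so a monomorphism can be tested on them. -/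
theorem Tree.edgeMap_injective_of_mono {S T : Tree} (f : S ⟶ T) [Mono f] :
    Function.Injective (edgeMap f) := by
  intro a b h
  have hop {ι : Type} [Finite ι] {x : ι → (linearTree 0).Edge} {c} (hx : IsSubtree _ x c)
      (e : S.Edge) : S.IsSubtree (fun _ : ι => e) e := by
    obtain ⟨⟨_⟩, -⟩ := (linearTree_isLinear 0).isSubtree_iff.1 hx
    exact ⟨fun _ => le_rfl, fun _ _ _ => Subsingleton.elim _ _, fun _ _ h => ⟨default, h⟩⟩
  let g (e : S.Edge) : linearTree 0 ⟶ S := homMk (fun _ => e) fun hx => hop hx e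
  have : g a ≫ f = g b ≫ f := hom_ext fun _ => h
  exact congrFun (congrArg edgeMap ((cancel_mono f).1 this)) (0 : Fin 1)

theorem isIso_of_mono_of_surjective {n : ℕ} {R : Tree} (i : R ⟶ linearTree n) [Mono i]
    (hi : Function.Surjective (Tree.edgeMap i)) : IsIso i := by
  have hinj := Tree.edgeMap_injective_of_mono i
  have htot (a b : R.Edge) : a ≤ b ∨ b ≤ a := by
    rcases le_total (α := Fin (n + 1)) (Tree.edgeMap i a) (Tree.edgeMap i b) with h | h
    · exact Tree.comparable_of_hom i h
    · exact (Tree.comparable_of_hom i h).symm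
  let σ := Equiv.ofBijective _ ⟨hinj, hi⟩
  have hσ (a : (linearTree n).Edge) : Tree.edgeMap i (σ.symm a) = a := σ.apply_symm_apply a
  -- The inverse bijection is monotone because `R` is totally ordered; any leaf of `R` is its top
  -- edge, so the leaf condition is automatic.
  let j : linearTree n ⟶ R := Tree.homMk σ.symm fun {ι _ x c} hx => by
    obtain ⟨⟨_⟩, h⟩ := (linearTree_isLinear n).isSubtree_iff.1 hx
    refine ⟨fun k => (htot _ _).elim id fun h' => ?_, fun _ _ _ => Subsingleton.elim _ _,
      fun l hl _ => ⟨default, (htot _ _).elim id fun h' => (R.leaf_max hl h').le⟩⟩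
    have := Tree.hom_monotone i h'
    rw [hσ, hσ] at this
    rw [le_antisymm (h k) this]
  exact ⟨j, Tree.hom_ext σ.symm_apply_apply, Tree.hom_ext σ.apply_symm_apply⟩

/-- A dendrex onto all edges would make the face through which it factors surjective, hence an
isomorphism. -/
theorem range_ne_univ_of_mem_boundary {n : ℕ} {S : Tree} (x : S ⟶ linearTree n)
    (hx : x ∈ (boundary (linearTree n)).obj (.op S)) :
    Set.range (Tree.edgeMap x) ≠ Set.univ := by
  obtain ⟨R, i, g, hi, hi', rfl⟩ := hx
  refine fun h => hi' (isIso_of_mono_of_surjective i fun a => ?_)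
  obtain ⟨e, he⟩ := Set.range_eq_univ.1 h a
  exact ⟨Tree.edgeMap g e, he⟩

theorem incl_mem_boundary {n : ℕ} (s : Set (Fin (n + 1))) (hs : s.Nonempty) (h : s ≠ Set.univ) :
    subLinearTree.incl s hs ∈ (boundary (linearTree n)).obj (.op (subLinearTree s hs)) := by
  refine ⟨_, subLinearTree.incl s hs, 𝟙 _, ⟨fun f g hfg => ?_⟩, fun hi => h ?_, Category.id_comp _⟩
  · exact Tree.hom_ext fun e => Subtype.ext (congrFun (congrArg Tree.edgeMap hfg) e)
  · refine Set.eq_univ_of_forall fun a => ?_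
    let b : s := Tree.edgeMap (inv (subLinearTree.incl s hs)) a
    have hb : b.1 = a :=
      congrFun (congrArg Tree.edgeMap (IsIso.inv_hom_id (subLinearTree.incl s hs))) a
    exact hb ▸ b.2

/-! ## The Boardman-Vogt tensor product with a linear tree -/

namespace BV

/-- The operation `p ⊗ d` of the tensor product. -/
def left {P : Operad.{u₁, v₁}} (Q : Operad.{u₂, v₂}) {ι : Type} [Finite ι] {x : ι → P.Color}
    {c : P.Color} (p : P.Op x c) (d : Q.Color) : (BV P Q).Op (fun i => (x i, d)) (c, d) :=
  Quotient.mk _ (.left p d)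

/-- The operation `c ⊗ q` of the tensor product. -/
def right (P : Operad.{u₁, v₁}) {Q : Operad.{u₂, v₂}} {κ : Type} [Finite κ] {y : κ → Q.Color}
    {d : Q.Color} (c : P.Color) (q : Q.Op y d) : (BV P Q).Op (fun k => (c, y k)) (c, d) :=
  Quotient.mk _ (.right c q)

section

variable {P : Operad.{u₁, v₁}} {Q : Operad.{u₂, v₂}}

theorem comp_mk {ι : Type} {κ : ι → Type} [Finite ι] [∀ i, Finite (κ i)]
    {x : ι → P.Color × Q.Color} {y : (i : ι) → κ i → P.Color × Q.Color} {c : P.Color × Q.Color}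
    (p : BVTerm P Q x c) (q : (i : ι) → BVTerm P Q (y i) (x i)) :
    (BV P Q).comp (Quotient.mk (BVSetoid P Q x c) p)
        (fun i => Quotient.mk (BVSetoid P Q (y i) (x i)) (q i)) =
      Quotient.mk (BVSetoid P Q _ c) (.comp p q) :=
  Quotient.sound (.comp_congr (Quotient.mk_out p) fun i => Quotient.mk_out (q i))

theorem left_id (c : P.Color) (d : Q.Color) :
    left Q (P.id c) d = (BV P Q).id (c, d) :=
  Quotient.sound (.left_id c d)

theorem left_reindex {ι κ : Type} [Finite ι] [Finite κ] {x : ι → P.Color} {c : P.Color}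
    (e : κ ≃ ι) (p : P.Op x c) (d : Q.Color) :
    left Q (P.reindex e p) d = (BV P Q).reindex e (left Q p d) :=
  Quotient.sound (.left_reindex e p d)

theorem left_comp {ι : Type} {κ : ι → Type} [Finite ι] [∀ i, Finite (κ i)]
    {x : ι → P.Color} {y : (i : ι) → κ i → P.Color} {c : P.Color}
    (p : P.Op x c) (q : (i : ι) → P.Op (y i) (x i)) (d : Q.Color) :
    left Q (P.comp p q) d = (BV P Q).comp (left Q p d) (fun i => left Q (q i) d) :=
  (Quotient.sound (s := BVSetoid P Q _ _) (BVRel.left_comp p q d)).trans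
    (comp_mk (.left p d) (fun i => .left (q i) d)).symm

theorem right_id (c : P.Color) (d : Q.Color) :
    right P c (Q.id d) = (BV P Q).id (c, d) :=
  Quotient.sound (.right_id c d)

theorem right_reindex {ι κ : Type} [Finite ι] [Finite κ] {y : ι → Q.Color} {d : Q.Color}
    (e : κ ≃ ι) (c : P.Color) (q : Q.Op y d) :
    right P c (Q.reindex e q) = (BV P Q).reindex e (right P c q) :=
  Quotient.sound (.right_reindex e c q)

theorem right_comp {ι : Type} {κ : ι → Type} [Finite ι] [∀ i, Finite (κ i)]
    {x : ι → Q.Color} {y : (i : ι) → κ i → Q.Color} {d : Q.Color} (c : P.Color)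
    (p : Q.Op x d) (q : (i : ι) → Q.Op (y i) (x i)) :
    right P c (Q.comp p q) = (BV P Q).comp (right P c p) (fun i => right P c (q i)) :=
  (Quotient.sound (s := BVSetoid P Q _ _) (BVRel.right_comp c p q)).trans
    (comp_mk (.right c p) (fun i => .right c (q i))).symm

theorem interchange {ι κ : Type} [Finite ι] [Finite κ] {x : ι → P.Color} {c : P.Color}
    {y : κ → Q.Color} {d : Q.Color} (p : P.Op x c) (q : Q.Op y d) :
    (BV P Q).comp (left Q p d) (fun i => right P (x i) q) =
      (BV P Q).reindex (sigmaSwap ι κ)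
        ((BV P Q).comp (right P c q) (fun k => left Q p (y k))) :=
  (comp_mk _ _).trans ((Quotient.sound (s := BVSetoid P Q _ _) (BVRel.interchange p q)).trans
    (congrArg ((BV P Q).reindex (sigmaSwap ι κ))
      (comp_mk (.right c q) (fun k => .left p (y k))).symm))

end

/-! ### Normal forms of operations -/

variable {S T : Tree}

/-- The operation of the tensor product with `S` linear that is the composition of an operation of
`T` with unary operations of `S` at its inputs. -/
noncomputable def normalForm {ι : Type} [Finite ι] {z : ι → S.Edge × T.Edge}
    {c : S.Edge × T.Edge} (q : T.operad.Op (fun i => (z i).2) c.2)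
    (h : ∀ i, S.operad.Op (fun _ : Unit => (z i).1) c.1) : (BV S.operad T.operad).Op z c :=
  (BV S.operad T.operad).reindex (Equiv.sigmaUnique ι fun _ => Unit).symm
    ((BV S.operad T.operad).comp (right S.operad c.1 q) (fun i => left T.operad (h i) (z i).2))

/-- The operation is in normal form. -/
def IsNormal {ι : Type} [Finite ι] {z : ι → S.Edge × T.Edge}
    {c : S.Edge × T.Edge} (u : (BV S.operad T.operad).Op z c) : Prop :=
  ∃ q h, u = normalForm q h

theorem IsNormal.congr {ι : Type} [Finite ι] {z : ι → S.Edge × T.Edge}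
    {c : S.Edge × T.Edge} {u u' : (BV S.operad T.operad).Op z c} (hu : IsNormal u)
    (h : u' = u) : IsNormal u' :=
  h ▸ hu

theorem IsNormal.eq {ι : Type} [Finite ι] {z : ι → S.Edge × T.Edge}
    {c : S.Edge × T.Edge} {u u' : (BV S.operad T.operad).Op z c} (hu : IsNormal u)
    (hu' : IsNormal u') : u = u' := by
  obtain ⟨q, h, rfl⟩ := hu
  obtain ⟨q', h', rfl⟩ := hu'
  obtain rfl : q = q' := T.operad_isThin.eq _ _
  obtain rfl : h = h' := funext fun i => S.operad_isThin.eq _ _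
  rfl

/-- The bijection `e` is the standard one up to a bijection `ε : κ ≃ ι`, which equivariance absorbs
into `q`. -/
theorem isNormal_reindex_comp {ι : Type} [Finite ι] {y : ι → T.Edge} {x : ι → S.Edge}
    {c : S.Edge} {d : T.Edge} (q : T.operad.Op y d)
    (h : ∀ i, S.operad.Op (fun _ : Unit => x i) c) {κ : Type} [Finite κ]
    (e : κ ≃ Σ _ : ι, Unit) :
    IsNormal ((BV S.operad T.operad).reindex e ((BV S.operad T.operad).comp
      (right S.operad c q) (fun i => left T.operad (h i) (y i)))) := by
  obtain ⟨ε, rfl⟩ : ∃ ε : κ ≃ ι, e = (Equiv.sigmaUnique κ fun _ => Unit).symm.trans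
      (Equiv.sigmaCongrLeft (β := fun _ => Unit) ε) :=
    ⟨e.trans (Equiv.sigmaUnique ι fun _ => Unit), by ext <;> rfl⟩
  refine ⟨T.operad.reindex ε q, fun k => h (ε k), ?_⟩
  refine ((BV S.operad T.operad).reindex_reindex _ _ _).symm.trans
    (congrArg ((BV S.operad T.operad).reindex _) ?_)
  refine ((BV S.operad T.operad).comp_reindex_left ε _ _).symm.trans ?_
  exact congrArg ((BV S.operad T.operad).comp · fun k => left T.operad (h (ε k)) (y (ε k)))
    (right_reindex (P := S.operad) (Q := T.operad) ε c q).symm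

theorem isNormal_comp {ι : Type} [Finite ι] {y : ι → T.Edge} {x : ι → S.Edge}
    {c : S.Edge} {d : T.Edge} (q : T.operad.Op y d)
    (h : ∀ i, S.operad.Op (fun _ : Unit => x i) c) :
    IsNormal ((BV S.operad T.operad).comp
      (right S.operad c q) (fun i => left T.operad (h i) (y i))) :=
  (isNormal_reindex_comp q h (Equiv.refl _)).congr ((BV S.operad T.operad).reindex_refl _).symm

theorem IsNormal.reindex {ι κ : Type} [Finite ι] [Finite κ] {z : ι → S.Edge × T.Edge}
    {c : S.Edge × T.Edge} {u : (BV S.operad T.operad).Op z c} (hu : IsNormal u) (e : κ ≃ ι) :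
    IsNormal ((BV S.operad T.operad).reindex e u) := by
  obtain ⟨q, h, rfl⟩ := hu
  exact (isNormal_reindex_comp q h (e.trans (Equiv.sigmaUnique ι fun _ => Unit).symm)).congr
    ((BV S.operad T.operad).reindex_reindex _ _ _)

theorem IsNormal.of_reindex {ι κ : Type} [Finite ι] [Finite κ] {z : ι → S.Edge × T.Edge}
    {c : S.Edge × T.Edge} {u : (BV S.operad T.operad).Op z c} (e : κ ≃ ι)
    (hu : IsNormal ((BV S.operad T.operad).reindex e u)) : IsNormal u := by
  have h := (hu.reindex e.symm).congr ((BV S.operad T.operad).reindex_reindex e e.symm u).symm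
  -- The composite bijection is generalised so that replacing it by the identity also changes the
  -- type of the operation.
  have key : ∀ e' : ι ≃ ι, e' = Equiv.refl ι → IsNormal ((BV S.operad T.operad).reindex e' u) →
      IsNormal u := by
    rintro _ rfl h
    exact h.congr ((BV S.operad T.operad).reindex_refl u).symm
  exact key _ e.symm_trans_self h

/-- The identity of `d` serves as the operation of `T` at the root. -/
theorem isNormal_left_unit {a c : S.Edge} (p : S.operad.Op (fun _ : Unit => a) c) (d : T.Edge) :
    IsNormal (left T.operad p d) := by
  refine .of_reindex _ (.congr ?_ ((BV S.operad T.operad).id_comp (left T.operad p d)).symm)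
  exact (isNormal_comp (T.operad.id d) (fun _ => p)).congr
    (congrArg ((BV S.operad T.operad).comp · fun _ => left T.operad p d)
      (right_id (P := S.operad) (Q := T.operad) c d).symm)

theorem isNormal_left {ι : Type} [Finite ι] [Unique ι] {x : ι → S.operad.Color}
    {c : S.operad.Color} (p : S.operad.Op x c) (d : T.Edge) :
    IsNormal (left T.operad p d) := by
  obtain ⟨e⟩ : Nonempty (ι ≃ Unit) := ⟨Equiv.ofUnique _ _⟩
  obtain ⟨x', rfl⟩ : ∃ x' : Unit → S.operad.Color, x = fun i => x' (e i) :=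
    ⟨x ∘ e.symm, by ext; simp⟩
  let p' : S.operad.Op (fun _ : Unit => x' ()) c := S.operad.reindex e.symm p
  have hp : p = S.operad.reindex e p' := S.operad_isThin.eq _ _
  exact ((isNormal_left_unit p' d).reindex e).congr
    ((congrArg (left T.operad · d) hp).trans (left_reindex (Q := T.operad) e p' d))

/-- By associativity, the operations of `T` at the roots of the `u i` merge with `q`. -/
theorem IsNormal.comp_right {ι : Type} {κ : ι → Type} [Finite ι] [∀ i, Finite (κ i)]
    {y : ι → T.Edge} {c : S.Edge} {d : T.Edge} (q : T.operad.Op y d)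
    {z : (i : ι) → κ i → S.Edge × T.Edge}
    {u : (i : ι) → (BV S.operad T.operad).Op (z i) (c, y i)} (hu : ∀ i, IsNormal (u i)) :
    IsNormal ((BV S.operad T.operad).comp (right S.operad c q) u) := by
  choose q' h hu using hu
  obtain rfl := funext hu
  refine .congr (.reindex ?_ _) ((BV S.operad T.operad).comp_reindex_right _ _ _)
  refine .of_reindex _ (.congr ?_ ((BV S.operad T.operad).comp_assoc _ _
    (fun i k => left T.operad (h i k) (z i k).2)).symm)
  exact (isNormal_comp (T.operad.comp q q') (fun a => h a.1 a.2)).congr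
    (congrArg ((BV S.operad T.operad).comp · fun a => left T.operad (h a.1 a.2) (z a.1 a.2).2)
      (right_comp (P := S.operad) c q q').symm)

/-- This is where interchange enters: `p`, being unary, moves past the operation of `T` and is
copied to each of its inputs, where it merges with the operation of `S` already there. -/
theorem IsNormal.comp_left {κ : Type} [Finite κ] {a c : S.Edge} {d : T.Edge}
    (p : S.operad.Op (fun _ : Unit => a) c) {z : κ → S.Edge × T.Edge}
    {u : (BV S.operad T.operad).Op z (a, d)} (hu : IsNormal u) :
    IsNormal ((BV S.operad T.operad).comp (left T.operad p d) (fun _ => u)) := by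
  obtain ⟨q, h, rfl⟩ := hu
  refine .congr (.reindex ?_ _) ((BV S.operad T.operad).comp_reindex_right _ _ _)
  refine .of_reindex _ (.congr ?_ ((BV S.operad T.operad).comp_assoc _ _
    (fun _ k => left T.operad (h k) (z k).2)).symm)
  refine .congr ?_ (congrArg
    ((BV S.operad T.operad).comp · fun b : (Σ _ : Unit, κ) => left T.operad (h b.2) (z b.2).2)
    (interchange p q))
  refine .congr (.reindex ?_ _) ((BV S.operad T.operad).comp_reindex_left (sigmaSwap Unit κ) _
    (fun b => left T.operad (h b.1) (z b.1).2))
  refine .congr (.reindex ?_ _) ((BV S.operad T.operad).comp_assoc _ _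
    (fun k _ => left T.operad (h k) (z k).2))
  refine .comp_right q fun k => ?_
  have : Unique (Σ _ : Unit, Unit) := (Equiv.sigmaUnique Unit fun _ => Unit).unique
  exact (isNormal_left (S.operad.comp p fun _ => h k) (z k).2).congr (left_comp _ _ _).symm

/-- The unary operations at the inputs of `u` are first pushed through the `v i`; the remaining
operation of `T` at the root then merges with the results. -/
theorem IsNormal.comp {ι : Type} {κ : ι → Type} [Finite ι] [∀ i, Finite (κ i)]
    {x : ι → S.Edge × T.Edge} {z : (i : ι) → κ i → S.Edge × T.Edge} {c : S.Edge × T.Edge}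
    {u : (BV S.operad T.operad).Op x c} (hu : IsNormal u)
    {v : (i : ι) → (BV S.operad T.operad).Op (z i) (x i)} (hv : ∀ i, IsNormal (v i)) :
    IsNormal ((BV S.operad T.operad).comp u v) := by
  obtain ⟨q, h, rfl⟩ := hu
  refine .congr (.reindex ?_ _) ((BV S.operad T.operad).comp_reindex_left
    (Equiv.sigmaUnique ι fun _ => Unit).symm _ (fun a => v a.1))
  refine .congr (.reindex ?_ _) ((BV S.operad T.operad).comp_assoc _ _ (fun i _ => v i))
  exact .comp_right q fun i => (hv i).comp_left (h i)

/-- Induction on formal operations; linearity of `S` is needed for the generators `p ⊗ d`, where `p`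
must be unary. -/
theorem isNormal_mk (hS : S.IsLinear) {ι : Type} [Finite ι]
    {z : ι → S.operad.Color × T.operad.Color} {c : S.operad.Color × T.operad.Color}
    (t : BVTerm S.operad T.operad z c) :
    IsNormal (Quotient.mk (BVSetoid S.operad T.operad z c) t) := by
  induction t with
  | left p d =>
    obtain ⟨⟨_⟩, -⟩ := hS.isSubtree_iff.1 p.down
    exact isNormal_left p d
  | @right κ _ y d c q =>
    refine .of_reindex _ (.congr ?_ ((BV S.operad T.operad).comp_id (right S.operad c q)).symm)
    refine (isNormal_comp q (fun _ => S.operad.id c)).congr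
      (congrArg ((BV S.operad T.operad).comp (right S.operad c q)) (funext fun i => ?_))
    exact (left_id (Q := T.operad) c (y i)).symm
  | id c =>
    exact (isNormal_left_unit (S.operad.id c.1) c.2).congr
      (left_id (P := S.operad) (Q := T.operad) c.1 c.2).symm
  | reindex e p ih => exact ih.reindex e
  | comp p q ih ih' => exact (ih.comp ih').congr (comp_mk p q).symm

theorem isNormal (hS : S.IsLinear) {ι : Type} [Finite ι] {z : ι → S.Edge × T.Edge}
    {c : S.Edge × T.Edge} (u : (BV S.operad T.operad).Op z c) : IsNormal u := by
  induction u using Quotient.inductionOn with | _ t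
  exact isNormal_mk hS t

/-- Operations of the tensor product of a linear tree and a tree are determined by their inputs and
their output. -/
theorem isThin (hS : S.IsLinear) (T : Tree) : (BV S.operad T.operad).IsThin :=
  ⟨fun u v => (isNormal hS u).eq (isNormal hS v)⟩

theorem nonempty_op_iff (hS : S.IsLinear) {ι : Type} [Finite ι] {z : ι → S.Edge × T.Edge}
    {c : S.Edge × T.Edge} :
    Nonempty ((BV S.operad T.operad).Op z c) ↔
      T.IsSubtree (fun i => (z i).2) c.2 ∧ ∀ i, c.1 ≤ (z i).1 := by
  refine ⟨fun ⟨u⟩ => ?_, fun ⟨hq, h⟩ => ⟨normalForm ⟨hq⟩ fun i => ⟨?_⟩⟩⟩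
  · obtain ⟨q, h, -⟩ := isNormal hS u
    exact ⟨q.down, fun i => (h i).down.le ()⟩
  · exact hS.isSubtree_iff.2 ⟨⟨inferInstance⟩, fun _ => h i⟩

end BV

/-! ### Dendrices of the product as pairs of edge maps -/

namespace BV

variable {R S T : Tree}

theorem fst_monotone (hS : S.IsLinear) (φ : Operad.Hom R.operad (BV S.operad T.operad)) :
    Monotone (α := R.Edge) (β := S.Edge) fun e => (φ.color e).1 := by
  intro a b h
  have := R.isSubtree_of_antichain a {b} (by simpa using h) (by simp)
  exact ((nonempty_op_iff hS).1 ⟨φ.op (P := R.operad) ⟨this⟩⟩).2 ⟨b, .inl rfl⟩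

/-- The second component of a dendrex of the tensor product of a linear tree and a tree. -/
noncomputable def sndHom (hS : S.IsLinear) (φ : Operad.Hom R.operad (BV S.operad T.operad)) :
    R ⟶ T :=
  Tree.homMk (fun e => (φ.color e).2) fun hx =>
    ((nonempty_op_iff hS).1 ⟨φ.op (P := R.operad) ⟨hx⟩⟩).1

/-- The dendrex of the tensor product of a linear tree and `R` given by a monotone map and the
identity of `R`. -/
noncomputable def graphHom (hS : S.IsLinear) (k : R.Edge → S.Edge) (hk : Monotone k) :
    Operad.Hom R.operad (BV S.operad R.operad) :=
  (isThin hS R).hom (P := R.operad) (fun e => (k e, e)) fun p =>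
    (nonempty_op_iff hS).2 ⟨p.down, fun i => hk (p.down.le i)⟩

end BV

/-! ## Elements of the tensor product over `Δ[n] ⊗ Ω[T]` -/

section

variable {n : ℕ} {T : Tree} {X Y : DSet} (α : X ⟶ representable (linearTree n))
  (β : Y ⟶ representable T)

/-- The map on edges underlying a generator of a tensor product over `Δ[n] ⊗ Ω[T]`. -/
def TensorCell.edgeMap {R : Tree} (u : TensorCell X Y R) (e : R.Edge) : Fin (n + 1) × T.Edge :=
  (Tree.edgeMap (S := u.S) (T := linearTree n) (α.app _ u.x) (u.φ.color e).1,
    Tree.edgeMap (S := u.T) (T := T) (β.app _ u.y) (u.φ.color e).2)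

theorem TensorRel.edgeMap_eq {R : Tree} {u v : TensorCell X Y R} (h : TensorRel X Y R u v) :
    u.edgeMap α β = v.edgeMap α β := by
  obtain ⟨a, b, x, y, φ⟩ := h
  funext e
  simp only [TensorCell.edgeMap, NatTrans.naturality_apply]
  rfl

/-- The map on edges underlying an element of a tensor product over `Δ[n] ⊗ Ω[T]`. -/
def tensorEdgeMap {R : Tree} : (tensorObj X Y).obj (.op R) → R.Edge → Fin (n + 1) × T.Edge :=
  Quot.lift (TensorCell.edgeMap α β) fun _ _ h => h.edgeMap_eq α β

/-- The image of every dendrex of `X` in `[n]` is again a dendrex of `X`. -/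
def ContainsImages : Prop :=
  ∀ (S : Tree) (x : X.obj (.op S)) (s : Set (Fin (n + 1))) (hs : s.Nonempty),
    s = Set.range (Tree.edgeMap (S := S) (T := linearTree n) (α.app _ x)) →
      ∃ x' : X.obj (.op (subLinearTree s hs)), α.app _ x' = subLinearTree.incl s hs

variable {α β}

/-- An element of a tensor product over `Δ[n] ⊗ Ω[T]` is determined by the image in `[n]`,
a monotone map onto it, and a dendrex of `Y`. -/
theorem exists_graph (hα : ∀ S, Function.Injective (α.app S)) (hX : ContainsImages α)
    {R : Tree} (u : TensorCell X Y R) {k : R.Edge → Fin (n + 1)} {f : R.Edge → T.Edge}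
    (h : ∀ e, u.edgeMap α β e = (k e, f e)) (hs : (Set.range k).Nonempty) :
    ∃ (hk : Monotone (Set.rangeFactorization k)) (x : X.obj (.op (subLinearTree (Set.range k) hs)))
      (y : Y.obj (.op R)), α.app _ x = subLinearTree.incl _ hs ∧
      (∀ e, Tree.edgeMap (S := R) (T := T) (β.app _ y) e = f e) ∧
      Quot.mk (TensorRel X Y R) u = Quot.mk _ ⟨subLinearTree (Set.range k) hs, R, x, y,
        BV.graphHom (S := subLinearTree (Set.range k) hs) (subLinearTree_isLinear _ _)
          (Set.rangeFactorization k) hk⟩ := by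
  obtain ⟨S, T', x, y, φ⟩ := u
  let xS : S ⟶ linearTree n := α.app _ x
  -- Here `s` is the image of all of `S`, which may exceed the range of `k`: not every edge of `S`
  -- need be hit by `φ`.
  obtain ⟨s, hs', hxs⟩ : ∃ s : Set (Fin (n + 1)), s.Nonempty ∧ s = Set.range (Tree.edgeMap xS) :=
    ⟨_, Set.range_nonempty_iff_nonempty.2 ⟨S.root⟩, rfl⟩
  obtain ⟨x₁, hx₁⟩ := hX S x s hs' hxs
  have hlin := subLinearTree_isLinear s hs'
  let a : S ⟶ subLinearTree s hs' := subLinearTree.lift xS s hs' fun e => hxs ▸ ⟨e, rfl⟩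
  have hax : X.map a.op x₁ = x := by
    apply hα
    rw [NatTrans.naturality_apply, hx₁]
    exact Tree.hom_ext (f := a ≫ subLinearTree.incl s hs') (g := xS) fun _ => rfl
  -- Pushing `φ` forward along `a` replaces `S` by a linear tree, over which the product operad is
  -- thin.
  let φ₁ := φ.trans (BV.map a (𝟙 T'))
  have hk₁ (e : R.Edge) : (φ₁.color e).1.1 = k e := congrArg Prod.fst (h e)
  have hkm : Monotone (Set.rangeFactorization k) := fun e e' he => by
    have : (φ₁.color e).1.1 ≤ (φ₁.color e').1.1 := BV.fst_monotone hlin φ₁ he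
    rw [hk₁, hk₁] at this
    exact this
  have hsub : Set.range k ⊆ s := by
    rintro _ ⟨e, rfl⟩
    rw [← hk₁]
    exact (φ₁.color e).1.2
  let i := subLinearTree.map hs hs' hsub
  let g : R ⟶ T' := BV.sndHom hlin φ₁
  -- The dendrex `φ₁` is the graph of `k` pushed forward along `i` and `g`, so `x₁` and `y` are
  -- pulled back along these. Only the second component is a morphism of trees out of `R`, which is
  -- why closure under images is required of `X` and not of `Y`.
  refine ⟨hkm, X.map i.op x₁, Y.map g.op y, ?_, fun e => ?_, ?_⟩
  · rw [NatTrans.naturality_apply, hx₁]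
    rfl
  · rw [NatTrans.naturality_apply]
    exact congrArg Prod.snd (h e)
  · have h1 := Quot.sound (TensorRel.mk a (𝟙 T') x₁ y φ)
    have h2 := Quot.sound (TensorRel.mk i g x₁ y (BV.graphHom (S := subLinearTree (Set.range k) hs)
      (subLinearTree_isLinear _ _) (Set.rangeFactorization k) hkm))
    rw [hax, op_id, CategoryTheory.Functor.map_id] at h1
    refine h1.trans (Eq.trans ?_ h2.symm)
    congr 2
    refine (BV.isThin hlin T').hom_ext fun e => Prod.ext (Subtype.ext (hk₁ e)) rfl

/-- Equal edge maps give canonical representatives with the same trees and graph, whose dendrices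
agree by injectivity of `α` and `β`. -/
theorem tensorEdgeMap_injective (hα : ∀ S, Function.Injective (α.app S)) (hX : ContainsImages α)
    (hβ : ∀ S, Function.Injective (β.app S)) {R : Tree} :
    Function.Injective (tensorEdgeMap α β (R := R)) := by
  intro u v h
  induction u using Quot.ind with | _ u
  induction v using Quot.ind with | _ v
  have h' : u.edgeMap α β = v.edgeMap α β := h
  have hs : (Set.range fun e => (u.edgeMap α β e).1).Nonempty := ⟨_, R.root, rfl⟩
  obtain ⟨_, x, y, hx, hy, hu⟩ := exists_graph hα hX u (fun e => rfl) hs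
  obtain ⟨_, x', y', hx', hy', hv⟩ := exists_graph hα hX v (fun e => (congrFun h' e).symm) hs
  obtain rfl : x = x' := hα _ (hx.trans hx'.symm)
  obtain rfl : y = y' := hβ _ (Tree.hom_ext fun e => (hy e).trans (hy' e).symm)
  exact hu.trans hv.symm

/-- The canonical representatives of `u` and `v` share their trees and graph. The dendrex of `X`
from `u` and the dendrex of `Y` from `v` then combine with this graph into `w`. -/
theorem exists_of_tensorEdgeMap_eq (hα : ∀ S, Function.Injective (α.app S))
    (hX : ContainsImages α) {R : Tree}
    (u : (tensorObj X (representable T)).obj (.op R))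
    (v : (tensorObj (representable (linearTree n)) Y).obj (.op R))
    (h : tensorEdgeMap α (𝟙 _) u = tensorEdgeMap (𝟙 _) β v) :
    ∃ w : (tensorObj X Y).obj (.op R),
      (tensorMap (𝟙 X) β).app _ w = u ∧ (tensorMap α (𝟙 Y)).app _ w = v := by
  induction u using Quot.ind with | _ u
  induction v using Quot.ind with | _ v
  have h' : u.edgeMap α (𝟙 _) = v.edgeMap (𝟙 _) β := h
  have hs : (Set.range fun e => (u.edgeMap α (𝟙 _) e).1).Nonempty := ⟨_, R.root, rfl⟩
  obtain ⟨hk, x, y, hx, hy, hu⟩ := exists_graph hα hX u (fun e => rfl) hs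
  obtain ⟨_, x', y', hx', hy', hv⟩ := exists_graph (fun _ => Function.injective_id)
    (fun _ _ _ _ _ => ⟨_, rfl⟩) v (fun e => (congrFun h' e).symm) hs
  obtain rfl : x' = α.app _ x := hx'.trans hx.symm
  obtain rfl : y = β.app _ y' := Tree.hom_ext fun e => (hy e).trans (hy' e).symm
  exact ⟨Quot.mk _ ⟨_, R, x, y', BV.graphHom (subLinearTree_isLinear _ _) _ hk⟩, hu.symm, hv.symm⟩

end

/-! ### The boundary inclusions, free action and injectivity -/

theorem containsImages_id (n : ℕ) : ContainsImages (𝟙 (representable (linearTree n))) :=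
  fun _ _ _ _ _ => ⟨_, rfl⟩

theorem containsImages_boundaryInclusion (n : ℕ) :
    ContainsImages (boundaryInclusion (linearTree n)) := by
  rintro S x s hs rfl
  exact ⟨⟨_, incl_mem_boundary _ hs (range_ne_univ_of_mem_boundary x.1 x.2)⟩, rfl⟩

theorem boundaryInclusion_injective (T : Tree) (S : Treeᵒᵖ) :
    Function.Injective ((boundaryInclusion T).app S) :=
  Subtype.val_injective

/-- The action is free on all of `Δ[n] ⊗ Ω[T]`: the second component of `y` is a morphism of trees
out of `S` invariant under `a`. -/
theorem eq_of_tensor_map_eq {n : ℕ} {T S : Tree}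
    (y : (tensorObj (representable (linearTree n)) (representable T)).obj (.op S)) (a : S ≅ S)
    (h : (tensorObj (representable (linearTree n)) (representable T)).map a.hom.op y = y) :
    a = Iso.refl S := by
  have hs (u : TensorCell (representable (linearTree n)) (representable T) S) :
      (Set.range fun e => (u.edgeMap (𝟙 _) (𝟙 _) e).1).Nonempty := ⟨_, S.root, rfl⟩
  have h' := congrArg (tensorEdgeMap (𝟙 _) (𝟙 _)) h
  induction y using Quot.ind with | _ u
  obtain ⟨-, -, f, -, hf, -⟩ := exists_graph (α := 𝟙 _) (β := 𝟙 _) (fun _ => Function.injective_id)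
    (containsImages_id n) u (fun e => rfl) (hs u)
  refine Tree.iso_eq_refl_of_comp f a fun e => ?_
  exact (hf _).trans ((congrArg Prod.snd (congrFun h' e)).trans (hf e).symm)

theorem pushoutTensor_injective {n : ℕ} {T : Tree} (R : Tree) :
    Function.Injective ((pushoutTensor (boundaryInclusion (linearTree n))
      (boundaryInclusion T)).app (.op R)) := by
  let f := boundaryInclusion (linearTree n)
  let g := boundaryInclusion T
  have hf : ∀ S, Function.Injective (f.app S) := boundaryInclusion_injective (linearTree n)
  have hg : ∀ S, Function.Injective (g.app S) := boundaryInclusion_injective T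
  have hF : ContainsImages f := containsImages_boundaryInclusion n
  have hid (T : Tree) (S : Treeᵒᵖ) : Function.Injective ((𝟙 (representable T) : _ ⟶ _).app S) :=
    Function.injective_id
  -- Evaluation at `R` preserves the pushout, so every element comes from one of the two summands.
  have hsq := (IsPushout.of_hasPushout (tensorMap (𝟙 _) g) (tensorMap f (𝟙 _))).map
    ((evaluation _ _).obj (.op R))
  let l := (Limits.pushout.inl (tensorMap (𝟙 _) g) (tensorMap f (𝟙 _))).app (.op R)
  let r := (Limits.pushout.inr (tensorMap (𝟙 _) g) (tensorMap f (𝟙 _))).app (.op R)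
  have hlr (w) : l ((tensorMap (𝟙 _) g).app _ w) = r ((tensorMap f (𝟙 _)).app _ w) :=
    ConcreteCategory.congr_hom hsq.w w
  -- The edge map of the image in `Δ[n] ⊗ Ω[T]` suffices to separate the elements of the pushout.
  let D (x) := tensorEdgeMap (𝟙 (representable (linearTree n))) (𝟙 (representable T))
    ((pushoutTensor f g).app (.op R) x)
  have hl (u) : D (l u) = tensorEdgeMap f (𝟙 _) u := by
    have : (pushoutTensor f g).app (.op R) (l u) = (tensorMap f (𝟙 _)).app (.op R) u :=
      ConcreteCategory.congr_hom (NatTrans.congr_app (Limits.pushout.inl_desc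
        (tensorMap f (𝟙 _)) (tensorMap (𝟙 _) g) (tensorMap_comm f g)) (.op R)) u
    refine (congrArg (tensorEdgeMap (𝟙 _) (𝟙 _)) this).trans ?_
    induction u using Quot.ind with | _ u
    rfl
  have hr (u) : D (r u) = tensorEdgeMap (𝟙 _) g u := by
    have : (pushoutTensor f g).app (.op R) (r u) = (tensorMap (𝟙 _) g).app (.op R) u :=
      ConcreteCategory.congr_hom (NatTrans.congr_app (Limits.pushout.inr_desc
        (tensorMap f (𝟙 _)) (tensorMap (𝟙 _) g) (tensorMap_comm f g)) (.op R)) u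
    refine (congrArg (tensorEdgeMap (𝟙 _) (𝟙 _)) this).trans ?_
    induction u using Quot.ind with | _ u
    rfl
  have hlr' (u v) (h : D (l u) = D (r v)) : l u = r v := by
    rw [hl, hr] at h
    obtain ⟨w, rfl, rfl⟩ := exists_of_tensorEdgeMap_eq hf hF u v h
    exact hlr w
  intro x y hxy
  have h : D x = D y := congrArg (tensorEdgeMap (𝟙 _) (𝟙 _)) hxy
  obtain ⟨u, rfl⟩ | ⟨u, rfl⟩ : (∃ u, l u = x) ∨ ∃ u, r u = x :=
    Limits.Types.eq_or_eq_of_isPushout hsq x <;>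
  obtain ⟨v, rfl⟩ | ⟨v, rfl⟩ : (∃ u, l u = y) ∨ ∃ u, r u = y :=
    Limits.Types.eq_or_eq_of_isPushout hsq y
  · rw [hl, hl] at h
    exact congrArg l (tensorEdgeMap_injective hf hF (hid T) h)
  · exact hlr' u v h
  · exact (hlr' v u h.symm).symm
  · rw [hr, hr] at h
    exact congrArg r (tensorEdgeMap_injective (hid _) (containsImages_id n) hg h)

end Dendroidal

theorem proposition1p1 (n : ℕ) (T : Dendroidal.Tree) :
    Dendroidal.IsNormalMono
      (Dendroidal.pushoutTensor
        (Dendroidal.boundaryInclusion (Dendroidal.linearTree n))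
        (Dendroidal.boundaryInclusion T)) := by
  refine ⟨?_, fun S y _ a h => Dendroidal.eq_of_tensor_map_eq y a h⟩
  have (R : Dendroidal.Treeᵒᵖ) :=
    (mono_iff_injective _).2 (Dendroidal.pushoutTensor_injective (n := n) (T := T) R.unop)
  exact NatTrans.mono_of_mono_app _
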